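/- Conventions. A linear relation from $V$ to $W$ is a linear subspace of $V\times W$; $\operatorname{dom}$, $\operatorname{ran}$, $\ker$ have their usual meaning ($\ker R=\{v:\{v,0\}\in R\}$). For a linear relation $S$ in a Hilbert space $\mathfrak H$, $S^*=\{\{h,k\}:(k,f)=(h,g)\text{ for all }\{f,g\}\in S\}$; $S$ is symmetric if $S\subset S^*$ and selfadjoint if $S=S^*$. The defect numbers $n_\pm(S)$ of a closed symmetric $S$ are the Hilbert space dimensions of $\ker(S^*-\lambda)$ for $\lambda$ in the open half-planes $\mathbb C_+$ and $\mathbb C_-$; they are equal if $\dim\ker(S^*-\lambda)=\dim\ker(S^*-\mu)$ for all $\lambda\in\mathbb C_+$, $\mu\in\mathbb C_-$. Let $\mathfrak H,\mathcal H$ be complex Hilbert spaces and $S$ a closed symmetric linear relation in $\mathfrak H$. A linear relation $\Gamma:\mathfrak H^2\to\mathcal H^2$ is a boundary relation for $S^*$ if $\operatorname{dom}\Gamma$ is a dense subset of $S^*$, Green's identity $$(f',g)_{\mathfrak H}-(f,g')_{\mathfrak H}=(h',k)_{\mathcal H}-(h,k')_{\mathcal H}$$ holds for all $\{\hat f,\hat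 h\},\{\hat g,\hat k\}\in\Gamma$, where $\hat f=\{f,f'\}$, $\hat h=\{h,h'\}$, $\hat g=\{g,g'\}$, $\hat k=\{k,k'\}$, and every $\{\hat g,\hat k\}\in\mathfrak H^2\times\mathcal H^2$ satisfying this identity for all $\{\hat f,\hat h\}\in\Gamma$ belongs to $\Gamma$. Put $\Gamma_0=\{\{\hat f,h\}:\{\hat f,\{h,h'\}\}\in\Gamma\}$. Conditions: (B1) Green's identity holds on $\Gamma$; (B2) $\operatorname{ran}\Gamma_0=\mathcal H$; (B3) $\ker\Gamma_0$ is selfadjoint. For $\lambda\in\mathbb C\setminus\mathbb R$, the Weyl family and the $\gamma$-field are $$M(\lambda)=\{\hat h:\{\{f,\lambda f\},\hat h\}\in\Gamma\text{ for some }f\},\qquad \gamma(\lambda)=\{\{h,f\}:\{\{f,\lambda f\},\{h,h'\}\}\in\Gamma\text{ for some }h'\}.$$ **Proposition.** Let $\Gamma$ be a boundary relation for $S^*$ satisfying (B1)–(B3), and let $\mathcal H=\mathcal H_1\oplus\mathcal H_2$ be an orthogonal decomposition into closed subspaces, with orthogonal projections $P_{\mathcal H_1}$, $P_{\mathcal H_2}$.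 Then: (i) The linear relation $H^{(1)}=\{\hat f\in S^*:\{\hat f,\{0,h'\}\}\in\Gamma\text{ for some }h'\in\mathcal H_2\}$ is closed and symmetric in $\mathfrak H$ and has equal defect numbers. (ii) With $\mathcal P^{(1)}=\{\{\{h,h'\},\{h,P_{\mathcal H_1}h'\}\}:h\in\mathcal H_1,\ h'\in\mathcal H\}$, the linear relation $$\Gamma^{(1)}:=\mathcal P^{(1)}\circ\Gamma=\{\{\hat f,\{h,P_{\mathcal H_1}h'\}\}:\{\hat f,\{h,h'\}\}\in\Gamma,\ h\in\mathcal H_1,\ h'\in\mathcal H\}:\mathfrak H^2\to\mathcal H_1^2$$ is a boundary relation for $(H^{(1)})^*$ and satisfies (B1)–(B3). (iii) $T^{(1)}:=\operatorname{dom}\Gamma^{(1)}$ is dense in $(H^{(1)})^*$, and $T^{(1)}=\{\hat f\in S^*:\{\hat f,\{h,h'\}\}\in\Gamma\text{ for some }h,h'\in\mathcal H\text{ with }P_{\mathcal H_2}h=0\}$. (iv) For every $\lambda\in\mathbb C\setminus\mathbb R$, $M(\lambda)$ and $\gamma(\lambda)$ are (graphs of) everywhere defined bounded operators, $M(\lambda):\mathcal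 H\to\mathcal H$ and $\gamma(\lambda):\mathcal H\to\mathfrak H$, and the $\gamma$-field $\gamma_1$ and the Weyl family $M_1$ of $\Gamma^{(1)}$ are (graphs of) the bounded operators $$\gamma_1(\lambda)=\gamma(\lambda){\upharpoonright}\mathcal H_1,\qquad M_1(\lambda)=M_{11}(\lambda)=P_{\mathcal H_1}M(\lambda){\upharpoonright}\mathcal H_1.$$ -/

import Mathlib

/-! Linear relations between complex inner product spaces are linear subspaces of the product;
the adjoint of a linear relation is `Submodule.adjoint`. The inner product
`(f, g)`, linear in `f`, is `inner ℂ g f`. -/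

namespace BoundaryRel

section LinearRelations

variable {V W U : Type*} [AddCommGroup V] [Module ℂ V] [AddCommGroup W] [Module ℂ W]
  [AddCommGroup U] [Module ℂ U]

/-- Domain of a linear relation. -/
def dom (R : Submodule ℂ (V × W)) : Submodule ℂ V := R.map (LinearMap.fst ℂ V W)

/-- Range of a linear relation. -/
def ran (R : Submodule ℂ (V × W)) : Submodule ℂ W := R.map (LinearMap.snd ℂ V W)

/-- Kernel of a linear relation: all `v` with `(v, 0) ∈ R`. -/
def ker (R : Submodule ℂ (V × W)) : Submodule ℂ V := R.comap (LinearMap.inl ℂ V W)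

/-- The product `A ∘ B` of linear relations `B : V → W` and `A : W → U`. -/
def comp (A : Submodule ℂ (W × U)) (B : Submodule ℂ (V × W)) : Submodule ℂ (V × U) where
  carrier := {p | ∃ w : W, (p.1, w) ∈ B ∧ (w, p.2) ∈ A}
  zero_mem' := ⟨0, B.zero_mem, A.zero_mem⟩
  add_mem' := by
    rintro p q ⟨w, hB, hA⟩ ⟨w', hB', hA'⟩
    exact ⟨w + w', B.add_mem hB hB', A.add_mem hA hA'⟩
  smul_mem' := by
    rintro c p ⟨w, hB, hA⟩
    exact ⟨c • w, B.smul_mem c hB, A.smul_mem c hA⟩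

/-- The eigenspace `N_z(T) = ker (T - z)` of a linear relation `T` in `V`:
all `f` with `(f, z f) ∈ T`. -/
def eigenspace (T : Submodule ℂ (V × V)) (z : ℂ) : Submodule ℂ V :=
  T.comap (LinearMap.prod LinearMap.id (z • LinearMap.id))

end LinearRelations

section HilbertSpaces

variable {E K : Type*} [NormedAddCommGroup E] [InnerProductSpace ℂ E]
  [NormedAddCommGroup K] [InnerProductSpace ℂ K]

/-- A linear relation `S` is symmetric if `S ⊆ S*`. -/
def IsSymmetricRel (S : Submodule ℂ (E × E)) : Prop := S ≤ S.adjoint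

/-- A linear relation `A` is selfadjoint if `A = A*`. -/
def IsSelfAdjointRel (A : Submodule ℂ (E × E)) : Prop := A = A.adjoint

/-- Hilbert space dimension: the largest cardinality of an orthonormal system (in a Hilbert space,
the cardinality of any orthonormal basis). -/
noncomputable def hilbertDim (V : Type*) [NormedAddCommGroup V] [InnerProductSpace ℂ V] :
    Cardinal :=
  ⨆ w : {w : Set V // Orthonormal ℂ ((↑) : w → V)}, Cardinal.mk w.1

/-- The dimension of the defect subspace `N_z(S*)`. -/
noncomputable def defectNumber (S : Submodule ℂ (E × E)) (z : ℂ) : Cardinal :=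
  hilbertDim (eigenspace S.adjoint z)

/-- Equal defect numbers: the defect subspaces at points of the open upper half-plane have the same
dimension as those at points of the open lower half-plane. -/
def HasEqualDefectNumbers (S : Submodule ℂ (E × E)) : Prop :=
  ∀ z w : ℂ, 0 < z.im → w.im < 0 → defectNumber S z = defectNumber S w

/-- Green's identity `(f', g) - (f, g') = (h', k) - (h, k')` for the elements
`p = ((f, f'), (h, h'))` and `q = ((g, g'), (k, k'))`. -/
def GreenIdentity (p q : (E × E) × (K × K)) : Prop :=
  inner ℂ q.1.1 p.1.2 - inner ℂ q.1.2 p.1.1 = inner ℂ q.2.1 p.2.2 - inner ℂ q.2.2 p.2.1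

/-- `Γ` is a boundary relation for `S*`, where `S` is a closed symmetric linear relation. -/
structure IsBoundaryRelation (S : Submodule ℂ (E × E)) (Γ : Submodule ℂ ((E × E) × (K × K))) :
    Prop where
  isClosed : IsClosed (S : Set (E × E))
  isSymmetric : IsSymmetricRel S
  dom_le : dom Γ ≤ S.adjoint
  dom_dense : S.adjoint ≤ (dom Γ).topologicalClosure
  green : ∀ p ∈ Γ, ∀ q ∈ Γ, GreenIdentity p q
  maximal : ∀ q, (∀ p ∈ Γ, GreenIdentity p q) → q ∈ Γ

/-- The component `Γ₀ = {(f̂, h) : (f̂, (h, h')) ∈ Γ}`. -/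
def Gamma0 (Γ : Submodule ℂ ((E × E) × (K × K))) : Submodule ℂ ((E × E) × K) :=
  Γ.map (LinearMap.prodMap LinearMap.id (LinearMap.fst ℂ K K))

/-- The conditions (B1)-(B3): Green's identity holds, `ran Γ₀` is the whole space, and
`ker Γ₀` is selfadjoint. -/
structure SatisfiesB (Γ : Submodule ℂ ((E × E) × (K × K))) : Prop where
  b1 : ∀ p ∈ Γ, ∀ q ∈ Γ, GreenIdentity p q
  b2 : ran (Gamma0 Γ) = ⊤
  b3 : IsSelfAdjointRel (ker (Gamma0 Γ))

/-- The linear map `(f, ĥ) ↦ ((f, z f), ĥ)`. -/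
def eigenEmbedding (E K : Type*) [NormedAddCommGroup E] [InnerProductSpace ℂ E]
    [NormedAddCommGroup K] [InnerProductSpace ℂ K] (z : ℂ) :
    (E × (K × K)) →ₗ[ℂ] ((E × E) × (K × K)) :=
  LinearMap.prodMap (LinearMap.prod LinearMap.id (z • LinearMap.id)) LinearMap.id

/-- The Weyl family: `M(z) = {ĥ : ((f, z f), ĥ) ∈ Γ for some f}`. -/
def weylFamily (Γ : Submodule ℂ ((E × E) × (K × K))) (z : ℂ) : Submodule ℂ (K × K) :=
  ran (Γ.comap (eigenEmbedding E K z))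

/-- The `γ`-field: `γ(z) = {(h, f) : ((f, z f), (h, h')) ∈ Γ for some h'}`. -/
def gammaField (Γ : Submodule ℂ ((E × E) × (K × K))) (z : ℂ) : Submodule ℂ (K × E) :=
  (Γ.comap (eigenEmbedding E K z)).map
    (LinearMap.prod (LinearMap.fst ℂ K K ∘ₗ LinearMap.snd ℂ E (K × K))
      (LinearMap.fst ℂ E (K × K)))

/-- The linear relation `P = {((h, h'), (h, P_{K₁} h')) : h ∈ K₁, h' ∈ K}` from `K × K` to
`K₁ × K₁`. -/
def compressionRel (K₁ : Submodule ℂ K) [K₁.HasOrthogonalProjection] :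
    Submodule ℂ ((K × K) × (K₁ × K₁)) where
  carrier := {p | p.1.1 = (p.2.1 : K) ∧ p.2.2 = K₁.orthogonalProjectionOnto p.1.2}
  zero_mem' := by simp
  add_mem' := by
    rintro p q ⟨h1, h2⟩ ⟨h3, h4⟩
    exact ⟨by simp [h1, h3], by simp [h2, h4]⟩
  smul_mem' := by
    rintro c p ⟨h1, h2⟩
    exact ⟨by simp [h1], by simp [h2]⟩

/-- The relation `Γ⁽¹⁾ = P ∘ Γ`, from `E × E` to `K₁ × K₁`. -/
def compressed (Γ : Submodule ℂ ((E × E) × (K × K))) (K₁ : Submodule ℂ K)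
    [K₁.HasOrthogonalProjection] : Submodule ℂ ((E × E) × (K₁ × K₁)) :=
  comp (compressionRel K₁) Γ

/-- The relation `H⁽¹⁾ = {f̂ ∈ S* : (f̂, (0, h')) ∈ Γ for some h' ∈ K₂}`. -/
def interExt (S : Submodule ℂ (E × E)) (Γ : Submodule ℂ ((E × E) × (K × K)))
    (K₂ : Submodule ℂ K) : Submodule ℂ (E × E) where
  carrier := {f | f ∈ S.adjoint ∧ ∃ h' ∈ K₂, (f, ((0 : K), h')) ∈ Γ}
  zero_mem' := ⟨zero_mem _, 0, zero_mem _, Γ.zero_mem⟩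
  add_mem' := by
    rintro f g ⟨hf, h, hh, hΓ⟩ ⟨hg, k, hk, hΓ'⟩
    refine ⟨add_mem hf hg, h + k, add_mem hh hk, ?_⟩
    simpa using Γ.add_mem hΓ hΓ'
  smul_mem' := by
    rintro c f ⟨hf, h, hh, hΓ⟩
    refine ⟨Submodule.smul_mem _ c hf, c • h, Submodule.smul_mem _ c hh, ?_⟩
    simpa using Γ.smul_mem c hΓ

end HilbertSpaces

end BoundaryRel

namespace BoundaryRel

section LinearRelations

variable {V W : Type*} [AddCommGroup V] [Module ℂ V] [AddCommGroup W] [Module ℂ W]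

/-! Conditions (B1)-(B3) alone force maximality in Green's identity (`SatisfiesB.mem_of_green`), so
any relation satisfying them is a boundary relation for the closure of its domain. Compression
preserves (B1)-(B3): vectors of `K₁` pair only with the projection of `h'`, and `ker Γ₀` does not
change. It remains to identify `H⁽¹⁾` with `(dom Γ⁽¹⁾)*` (`interExt_eq_adjoint_dom`); closedness,
symmetry and density then follow from the double adjoint.

For the defect numbers, `A = ker Γ₀` is a selfadjoint relation inside `(H⁽¹⁾)*`. The maps `I + (z -
w)(A - z)⁻¹` are homeomorphisms between defect subspaces, and polar decomposition turns them into
unitaries.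

For (iv), solvability of `A - z` yields for each `h` exactly one eigen-element of `Γ`; the closed
graph theorem gives boundedness, and compressing the resulting graphs gives `γ₁` and `M₁`. -/

theorem mem_dom {R : Submodule ℂ (V × W)} {v : V} : v ∈ dom R ↔ ∃ w, (v, w) ∈ R := by
  simp [dom]

theorem mem_ran {R : Submodule ℂ (V × W)} {w : W} : w ∈ ran R ↔ ∃ v, (v, w) ∈ R := by
  simp [ran]

theorem mem_ker {R : Submodule ℂ (V × W)} {v : V} : v ∈ ker R ↔ (v, 0) ∈ R := Iff.rfl

theorem mem_eigenspace {T : Submodule ℂ (V × V)} {z : ℂ} {f : V} :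
    f ∈ eigenspace T z ↔ (f, z • f) ∈ T := Iff.rfl

end LinearRelations

/-! ### Adjoints and consequences of (B1)-(B3) -/

section HilbertSpaces

variable {E K : Type*} [NormedAddCommGroup E] [InnerProductSpace ℂ E]
  [NormedAddCommGroup K] [InnerProductSpace ℂ K]

theorem mem_adjoint {S : Submodule ℂ (E × E)} {x : E × E} :
    x ∈ S.adjoint ↔ ∀ p ∈ S, inner ℂ x.1 p.2 = inner ℂ x.2 p.1 := by
  rw [Submodule.mem_adjoint_iff]
  constructor
  · intro h p hp
    have := congrArg (starRingEnd ℂ) (sub_eq_zero.1 (h p.1 p.2 hp))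
    simpa using this
  · intro h a b hab
    have := congrArg (starRingEnd ℂ) (h (a, b) hab)
    simpa [sub_eq_zero] using this

theorem isClosed_adjoint (S : Submodule ℂ (E × E)) : IsClosed (S.adjoint : Set (E × E)) := by
  have : (S.adjoint : Set (E × E)) =
      ⋂ p ∈ S, {x : E × E | inner ℂ x.1 p.2 = inner ℂ x.2 p.1} := by
    ext x
    simp only [SetLike.mem_coe, Set.mem_iInter, Set.mem_ofPred_eq]
    exact BoundaryRel.mem_adjoint
  rw [this]
  exact isClosed_biInter fun p _ => isClosed_eq (by fun_prop) (by fun_prop)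

theorem le_adjoint_adjoint (S : Submodule ℂ (E × E)) : S ≤ S.adjoint.adjoint := by
  intro x hx
  rw [mem_adjoint]
  intro p hp
  have := congrArg (starRingEnd ℂ) (mem_adjoint.1 hp x hx)
  simpa using this.symm

/-- The second adjoint of a linear relation is its closure. -/
theorem adjoint_adjoint [CompleteSpace E] (S : Submodule ℂ (E × E)) :
    S.adjoint.adjoint = S.topologicalClosure := by
  apply le_antisymm
  · intro x hx
    -- The product carries the sup norm; passing to the `ℓ²` product makes orthogonal complements
    -- available, and `S*` is `S'ᗮ` rotated by `(a, b) ↦ (b, -a)`.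
    let e := WithLp.prodContinuousLinearEquiv 2 ℂ E E
    let S' : Submodule ℂ (WithLp 2 (E × E)) := S.comap (e : WithLp 2 (E × E) →ₗ[ℂ] E × E)
    have hx' : e.symm x ∈ S'ᗮᗮ := by
      rw [Submodule.mem_orthogonal]
      intro y hy
      have hy' : ((e y).2, -(e y).1) ∈ S.adjoint := by
        rw [mem_adjoint]
        intro p hp
        have := Submodule.inner_left_of_mem_orthogonal (u := e.symm p) (by simpa [S'] using hp) hy
        rw [WithLp.prod_inner_apply] at this
        have h2 : inner ℂ (e y).1 p.1 + inner ℂ (e y).2 p.2 = 0 := this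
        simp only [inner_neg_left]
        linear_combination h2
      have h3 := mem_adjoint.1 hx _ hy'
      have h4 := congrArg (starRingEnd ℂ) h3
      simp only [inner_neg_right, map_neg, inner_conj_symm] at h4
      rw [WithLp.prod_inner_apply]
      change inner ℂ (e y).1 x.1 + inner ℂ (e y).2 x.2 = 0
      linear_combination -h4
    rw [Submodule.orthogonal_orthogonal_eq_closure] at hx'
    have h5 : e (e.symm x) ∈ closure (e '' (S' : Set (WithLp 2 (E × E)))) :=
      image_closure_subset_closure_image e.continuous ⟨_, hx', rfl⟩
    rw [e.apply_symm_apply] at h5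
    exact closure_mono (by rintro _ ⟨y, hy, rfl⟩; exact hy) h5
  · exact Submodule.topologicalClosure_minimal _ (le_adjoint_adjoint S) (isClosed_adjoint _)

theorem mem_Gamma0 {Γ : Submodule ℂ ((E × E) × (K × K))} {f : E × E} {h : K} :
    (f, h) ∈ Gamma0 Γ ↔ ∃ h', (f, (h, h')) ∈ Γ := by
  simp [Gamma0]

theorem mem_ker_Gamma0 {Γ : Submodule ℂ ((E × E) × (K × K))} {f : E × E} :
    f ∈ ker (Gamma0 Γ) ↔ ∃ h', (f, ((0 : K), h')) ∈ Γ := by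
  rw [mem_ker, mem_Gamma0]

theorem SatisfiesB.exists_mem {Γ : Submodule ℂ ((E × E) × (K × K))} (hB : SatisfiesB Γ) (h : K) :
    ∃ f h', (f, (h, h')) ∈ Γ := by
  have : h ∈ ran (Gamma0 Γ) := hB.b2 ▸ Submodule.mem_top
  simpa [mem_ran, mem_Gamma0] using this

theorem GreenIdentity.sub {p q r : (E × E) × (K × K)} (hq : GreenIdentity p q)
    (hr : GreenIdentity p r) : GreenIdentity p (q - r) := by
  unfold GreenIdentity at *
  simp only [Prod.fst_sub, Prod.snd_sub, inner_sub_left]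
  linear_combination hq - hr

/-- Under (B1)-(B3), only zero satisfies Green's identity with every element of `Γ` when placed in
the last component. -/
theorem SatisfiesB.eq_zero_of_green {Γ : Submodule ℂ ((E × E) × (K × K))} (hB : SatisfiesB Γ)
    {k : K} (hk : ∀ p ∈ Γ, GreenIdentity p ((0 : E × E), ((0 : K), k))) : k = 0 := by
  obtain ⟨f, h', hp⟩ := hB.exists_mem k
  have := hk _ hp
  simpa [GreenIdentity] using this

/-- Properties (B1)-(B3) imply maximality with respect to Green's identity. -/
theorem SatisfiesB.mem_of_green {Γ : Submodule ℂ ((E × E) × (K × K))} (hB : SatisfiesB Γ)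
    {q : (E × E) × (K × K)} (hq : ∀ p ∈ Γ, GreenIdentity p q) : q ∈ Γ := by
  -- Subtracting an element of `Γ` with the same `h`-component leaves a first component in `(ker
  -- Γ₀)* = ker Γ₀`; a second subtraction leaves only the last slot.
  obtain ⟨g₀, k₀, h₀⟩ := hB.exists_mem q.2.1
  have h1 : ∀ p ∈ Γ, GreenIdentity p (q - (g₀, (q.2.1, k₀))) :=
    fun p hp => (hq p hp).sub (hB.b1 p hp _ h₀)
  have h2 : q.1 - g₀ ∈ ker (Gamma0 Γ) := by
    rw [hB.b3, mem_adjoint]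
    intro f hf
    obtain ⟨h', hf⟩ := mem_ker_Gamma0.1 hf
    have := h1 _ hf
    simpa [GreenIdentity, sub_eq_zero] using this
  obtain ⟨k₁, h₁⟩ := mem_ker_Gamma0.1 h2
  have h3 : q - (g₀, (q.2.1, k₀)) - (q.1 - g₀, ((0 : K), k₁)) =
      ((0 : E × E), ((0 : K), q.2.2 - k₀ - k₁)) := by
    ext <;> simp
  have h4 := hB.eq_zero_of_green fun p hp => h3 ▸ (h1 p hp).sub (hB.b1 p hp _ h₁)
  rw [h4] at h3
  have h5 : q = (g₀, (q.2.1, k₀)) + (q.1 - g₀, ((0 : K), k₁)) := by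
    rw [← sub_eq_zero, ← sub_sub, h3]
    rfl
  rw [h5]
  exact Γ.add_mem h₀ h₁

theorem SatisfiesB.isClosed {Γ : Submodule ℂ ((E × E) × (K × K))} (hB : SatisfiesB Γ) :
    IsClosed (Γ : Set ((E × E) × (K × K))) := by
  have : (Γ : Set ((E × E) × (K × K))) = ⋂ p ∈ Γ, {q | GreenIdentity p q} := by
    ext q
    simp only [SetLike.mem_coe, Set.mem_iInter, Set.mem_ofPred_eq]
    exact ⟨fun hq p hp => hB.b1 p hp q hq, hB.mem_of_green⟩
  rw [this]
  unfold GreenIdentity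
  exact isClosed_biInter fun p _ => isClosed_eq (by fun_prop) (by fun_prop)

/-- With zero boundary values on one side, Green's identity is exactly the adjoint condition;
maximality then supplies membership in `Γ`. -/
theorem SatisfiesB.mem_adjoint_dom {Γ : Submodule ℂ ((E × E) × (K × K))} (hB : SatisfiesB Γ)
    {f : E × E} : f ∈ (dom Γ).adjoint ↔ (f, (0 : K × K)) ∈ Γ := by
  constructor
  · intro hf
    refine hB.mem_of_green fun p hp => ?_
    have := mem_adjoint.1 hf p.1 (mem_dom.2 ⟨p.2, hp⟩)
    simpa [GreenIdentity, sub_eq_zero] using this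
  · intro hf
    rw [mem_adjoint]
    intro g hg
    obtain ⟨k, hk⟩ := mem_dom.1 hg
    simpa [GreenIdentity, sub_eq_zero] using hB.b1 _ hk _ hf

/-- A relation with properties (B1)-(B3) is a boundary relation for the closure of its domain. -/
theorem SatisfiesB.isBoundaryRelation [CompleteSpace E] {Γ : Submodule ℂ ((E × E) × (K × K))}
    (hB : SatisfiesB Γ) : IsBoundaryRelation (dom Γ).adjoint Γ where
  isClosed := isClosed_adjoint _
  isSymmetric := fun _ hf =>
    le_adjoint_adjoint _ (mem_dom.2 ⟨_, hB.mem_adjoint_dom.1 hf⟩)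
  dom_le := le_adjoint_adjoint _
  dom_dense := (adjoint_adjoint _).le
  green := hB.b1
  maximal := fun _ => hB.mem_of_green

/-! ### The compressed relation -/

section Compression

variable {Γ : Submodule ℂ ((E × E) × (K × K))} {K₁ : Submodule ℂ K} [K₁.HasOrthogonalProjection]

theorem mem_compressed {f : E × E} {h k : K₁} :
    (f, (h, k)) ∈ compressed Γ K₁ ↔
      ∃ h' : K, (f, ((h : K), h')) ∈ Γ ∧ k = K₁.orthogonalProjectionOnto h' := by
  constructor
  · rintro ⟨⟨a, h'⟩, h1, h2, h3⟩
    obtain rfl : a = h := h2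
    exact ⟨h', h1, h3⟩
  · rintro ⟨h', h1, h2⟩
    exact ⟨((h : K), h'), h1, rfl, h2⟩

theorem ker_Gamma0_compressed : ker (Gamma0 (compressed Γ K₁)) = ker (Gamma0 Γ) := by
  ext f
  simp only [mem_ker_Gamma0, mem_compressed]
  constructor
  · rintro ⟨_, h', h, _⟩
    exact ⟨h', by simpa using h⟩
  · rintro ⟨h', h⟩
    exact ⟨_, h', by simpa using h, rfl⟩

theorem SatisfiesB.compressed (hB : SatisfiesB Γ) : SatisfiesB (compressed Γ K₁) where
  b1 := by
    rintro ⟨f, h, _⟩ hp ⟨g, k, _⟩ hq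
    obtain ⟨h', hp', rfl⟩ := mem_compressed.1 hp
    obtain ⟨k', hq', rfl⟩ := mem_compressed.1 hq
    have := hB.b1 _ hp' _ hq'
    simpa [GreenIdentity] using this
  b2 := by
    rw [eq_top_iff]
    intro h _
    obtain ⟨f, h', hp⟩ := hB.exists_mem (h : K)
    exact mem_ran.2 ⟨f, mem_Gamma0.2 ⟨_, mem_compressed.2 ⟨h', hp, rfl⟩⟩⟩
  b3 := by
    rw [ker_Gamma0_compressed]
    exact hB.b3

/-- Both sides say that the compressed boundary values vanish: `h = 0`, and `h'` projects to zero in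
`K₁`, that is, `h' ∈ K₁ᗮ`. -/
theorem interExt_eq_adjoint_dom {S : Submodule ℂ (E × E)} (hS : dom Γ ≤ S.adjoint)
    (hB : SatisfiesB Γ) : interExt S Γ K₁ᗮ = (dom (BoundaryRel.compressed Γ K₁)).adjoint := by
  ext f
  rw [hB.compressed.mem_adjoint_dom, Prod.mk_zero_zero.symm, mem_compressed]
  constructor
  · rintro ⟨_, h', hh, hf⟩
    exact ⟨h', by simpa using hf, (Submodule.orthogonalProjectionOnto_eq_zero_iff.2 hh).symm⟩
  · rintro ⟨h', hf, hh⟩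
    exact ⟨hS (mem_dom.2 ⟨_, hf⟩), h', Submodule.orthogonalProjectionOnto_eq_zero_iff.1 hh.symm,
      by simpa using hf⟩

theorem mem_dom_compressed {f : E × E} :
    f ∈ dom (BoundaryRel.compressed Γ K₁) ↔ ∃ h ∈ K₁, ∃ h', (f, (h, h')) ∈ Γ := by
  rw [mem_dom]
  constructor
  · rintro ⟨⟨h, k⟩, hp⟩
    obtain ⟨h', hp, _⟩ := mem_compressed.1 hp
    exact ⟨h, h.2, h', hp⟩
  · rintro ⟨h, hh, h', hp⟩
    exact ⟨(⟨h, hh⟩, _), mem_compressed.2 ⟨h', hp, rfl⟩⟩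

end Compression

end HilbertSpaces

end BoundaryRel
namespace BoundaryRel

universe u

/-! ### Invariance of Hilbert space dimension -/

section HilbertDimension

/-- Two Hilbert spaces that are linearly homeomorphic are isometrically isomorphic (polar
decomposition of an invertible operator). -/
theorem nonempty_linearIsometryEquiv {V W : Type*} [NormedAddCommGroup V]
    [InnerProductSpace ℂ V] [CompleteSpace V] [NormedAddCommGroup W] [InnerProductSpace ℂ W]
    [CompleteSpace W] (e : V ≃L[ℂ] W) : Nonempty (V ≃ₗᵢ[ℂ] W) := by
  let T : V →L[ℂ] W := e
  let a : V →L[ℂ] V := T.adjoint ∘L T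
  have ha0 : 0 ≤ a := (ContinuousLinearMap.nonneg_iff_isPositive _).2
    (ContinuousLinearMap.isPositive_adjoint_comp_self T)
  have hau : IsUnit a := by
    let T' : W →L[ℂ] V := e.symm
    have h1 : T' ∘L T = 1 := by ext; simp [T, T']
    have h2 : T ∘L T' = 1 := by ext; simp [T, T']
    have h1' : T.adjoint ∘L T'.adjoint = 1 := by
      rw [← ContinuousLinearMap.adjoint_comp, h1]
      exact star_one (V →L[ℂ] V)
    have h2' : T'.adjoint ∘L T.adjoint = 1 := by
      rw [← ContinuousLinearMap.adjoint_comp, h2]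
      exact star_one (W →L[ℂ] W)
    refine ⟨⟨a, T' ∘L T'.adjoint, ?_, ?_⟩, rfl⟩
    · calc a * (T' ∘L T'.adjoint) = T.adjoint ∘L (T ∘L T') ∘L T'.adjoint := rfl
        _ = 1 := by rw [h2]; exact h1'
    · calc (T' ∘L T'.adjoint) * a = T' ∘L (T'.adjoint ∘L T.adjoint) ∘L T := rfl
        _ = 1 := by rw [h2']; exact h1
  have ha : IsStrictlyPositive a := hau.isStrictlyPositive ha0
  -- With `b = (T*T)^(-1/2)`, the operator `T b` is the unitary factor of `T`.
  let b : V →L[ℂ] V := CFC.rpow a (-(1 / 2))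
  have hba : b * a * b = 1 := CFC.conjugate_rpow_neg_one_half a ha
  have hb : b.adjoint = b :=
    (ContinuousLinearMap.isSelfAdjoint_iff'.1 (IsSelfAdjoint.of_nonneg CFC.rpow_nonneg))
  have hbu : Function.Surjective b := fun v => ⟨a (b v), DFunLike.congr_fun hba v⟩
  have hnorm : ∀ v, ‖T (b v)‖ = ‖v‖ := by
    intro v
    have h : inner ℂ (T (b v)) (T (b v)) = inner ℂ v v := by
      rw [← ContinuousLinearMap.adjoint_inner_right]
      rw [← hb, ContinuousLinearMap.adjoint_inner_left, hb]
      exact congrArg (inner ℂ v) (DFunLike.congr_fun hba v)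
    rw [inner_self_eq_norm_sq_to_K, inner_self_eq_norm_sq_to_K] at h
    have h' : ‖T (b v)‖ ^ 2 = ‖v‖ ^ 2 := by exact_mod_cast h
    exact (sq_eq_sq₀ (norm_nonneg _) (norm_nonneg _)).1 h'
  exact ⟨LinearIsometryEquiv.ofSurjective ⟨(T ∘L b : V →L[ℂ] W), hnorm⟩
    (e.surjective.comp hbu)⟩

theorem hilbertDim_congr {V W : Type u} [NormedAddCommGroup V] [InnerProductSpace ℂ V]
    [NormedAddCommGroup W] [InnerProductSpace ℂ W] (e : V ≃ₗᵢ[ℂ] W) :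
    hilbertDim V = hilbertDim W := by
  have key : ∀ {V W : Type u} [NormedAddCommGroup V] [InnerProductSpace ℂ V]
      [NormedAddCommGroup W] [InnerProductSpace ℂ W] (_ : V ≃ₗᵢ[ℂ] W),
      hilbertDim V ≤ hilbertDim W := by
    intro V W _ _ _ _ e
    refine ciSup_le' fun w => ?_
    have hw : Orthonormal ℂ ((↑) : (e '' w.1) → W) := by
      have h1 : Orthonormal ℂ (fun x : w.1 => e x) := w.2.comp_linearIsometryEquiv e
      have h2 := h1.toSubtypeRange
      have h3 : Set.range (fun x : w.1 => e x) = e '' w.1 := (Set.image_eq_range _ _).symm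
      rwa [h3] at h2
    rw [← Cardinal.mk_image_eq e.injective]
    exact le_ciSup Cardinal.bddAbove_of_small
      (⟨e '' w.1, hw⟩ : {w : Set W // Orthonormal ℂ ((↑) : w → W)})
  exact le_antisymm (key e) (key e.symm)

end HilbertDimension
end BoundaryRel
namespace BoundaryRel

/-! ### Resolvents of selfadjoint relations and defect subspaces -/

section Resolvent

variable {E : Type*} [NormedAddCommGroup E] [InnerProductSpace ℂ E]

/-- Symmetry makes the pairing of `p.1` with `p.2` real, so pairing `p.1` with `p.2 - z • p.1` has
imaginary part `-z.im * ‖p.1‖ ^ 2`; Cauchy-Schwarz finishes. -/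
theorem norm_le_of_mem_symmetric {A : Submodule ℂ (E × E)} (hA : IsSymmetricRel A) (z : ℂ)
    {p : E × E} (hp : p ∈ A) : |z.im| * ‖p.1‖ ≤ ‖p.2 - z • p.1‖ := by
  have h1 : inner ℂ p.1 p.2 = inner ℂ p.2 p.1 := mem_adjoint.1 (hA hp) p hp
  have h2 : (inner ℂ p.1 p.2 : ℂ).im = 0 := by
    rw [← Complex.conj_eq_iff_im, inner_conj_symm, h1]
  have h3 : (inner ℂ p.1 (p.2 - z • p.1) : ℂ).im = -(z.im * ‖p.1‖ ^ 2) := by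
    rw [inner_sub_right, inner_smul_right, inner_self_eq_norm_sq_to_K, Complex.sub_im, h2, zero_sub]
    change -(z * (‖p.1‖ : ℂ) ^ 2).im = _
    rw [← Complex.ofReal_pow, Complex.im_mul_ofReal]
  have h4 : |z.im| * ‖p.1‖ ^ 2 ≤ ‖p.1‖ * ‖p.2 - z • p.1‖ := by
    calc |z.im| * ‖p.1‖ ^ 2 = |(inner ℂ p.1 (p.2 - z • p.1) : ℂ).im| := by
          rw [h3, abs_neg, abs_mul, abs_of_nonneg (sq_nonneg ‖p.1‖)]
      _ ≤ ‖(inner ℂ p.1 (p.2 - z • p.1) : ℂ)‖ := Complex.abs_im_le_norm _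
      _ ≤ _ := norm_inner_le_norm _ _
  rcases (norm_nonneg p.1).eq_or_lt with h | h
  · rw [← h]; simp
  · exact le_of_mul_le_mul_left (by linarith) h

/-- A symmetric relation has no nonreal eigenvalues. -/
theorem eq_zero_of_mem_symmetric {A : Submodule ℂ (E × E)} (hA : IsSymmetricRel A) {z : ℂ}
    (hz : z.im ≠ 0) {f : E} (hf : (f, z • f) ∈ A) : f = 0 := by
  have h := norm_le_of_mem_symmetric hA z hf
  rw [sub_self, norm_zero] at h
  exact norm_le_zero_iff.1 (nonpos_of_mul_nonpos_right h (abs_pos.2 hz))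

variable [CompleteSpace E]

/-- The map `p ↦ p.2 - z • p.1` on `A` is bounded below, so its range is closed; a vector orthogonal
to the range would be an eigenvector of `A* = A` at the nonreal point `conj z`. -/
theorem exists_mem_selfAdjoint {A : Submodule ℂ (E × E)} (hA : IsSelfAdjointRel A) {z : ℂ}
    (hz : z.im ≠ 0) (x : E) : ∃ u, (u, x + z • u) ∈ A := by
  have hsym : IsSymmetricRel A := hA.le
  have hcl : IsClosed (A : Set (E × E)) := hA ▸ isClosed_adjoint A
  have : CompleteSpace A := hcl.completeSpace_coe
  let T : A →L[ℂ] E := (ContinuousLinearMap.snd ℂ E E - z • ContinuousLinearMap.fst ℂ E E) ∘L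
    A.subtypeL
  have hT : ∀ p : A, T p = p.1.2 - z • p.1.1 := fun _ => rfl
  have hz' : 0 < |z.im| := abs_pos.2 hz
  have hbound : ∀ p : A, ‖p‖ ≤ (1 + (1 + ‖z‖) / |z.im|) * ‖T p‖ := by
    intro p
    have h1 : ‖p.1.1‖ ≤ ‖T p‖ / |z.im| := by
      rw [le_div_iff₀ hz', mul_comm]
      exact norm_le_of_mem_symmetric hsym z p.2
    have h2 : ‖p.1.2‖ ≤ ‖T p‖ + ‖z‖ * (‖T p‖ / |z.im|) := by
      calc ‖p.1.2‖ = ‖T p + z • p.1.1‖ := by rw [hT, sub_add_cancel]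
        _ ≤ ‖T p‖ + ‖z‖ * ‖p.1.1‖ := (norm_add_le _ _).trans_eq (by rw [norm_smul])
        _ ≤ _ := by gcongr
    have h3 : (1 + (1 + ‖z‖) / |z.im|) * ‖T p‖ =
        ‖T p‖ + ‖T p‖ / |z.im| + ‖z‖ * (‖T p‖ / |z.im|) := by ring
    have h4 : 0 ≤ ‖T p‖ / |z.im| := by positivity
    have h5 : 0 ≤ ‖z‖ * (‖T p‖ / |z.im|) := by positivity
    rw [h3]
    change max ‖p.1.1‖ ‖p.1.2‖ ≤ _
    exact max_le (by linarith [norm_nonneg (T p)]) (by linarith)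
  have hanti : AntilipschitzWith (Real.toNNReal (1 + (1 + ‖z‖) / |z.im|)) T :=
    ContinuousLinearMap.antilipschitz_of_bound T fun p => by
      rw [Real.coe_toNNReal _ (by positivity)]
      exact hbound p
  have hran : IsClosed (T.range : Set E) := hanti.isClosed_range T.uniformContinuous
  have : CompleteSpace T.range := hran.completeSpace_coe
  have htop : T.range = ⊤ := by
    rw [← Submodule.orthogonal_eq_bot_iff, eq_bot_iff]
    intro y hy
    have hmem : (y, (starRingEnd ℂ z) • y) ∈ A := by
      rw [hA, mem_adjoint]
      intro p hp
      have := Submodule.inner_left_of_mem_orthogonal (LinearMap.mem_range_self _ ⟨p, hp⟩) hy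
      change inner ℂ y (p.2 - z • p.1) = 0 at this
      rw [inner_sub_right, inner_smul_right, sub_eq_zero] at this
      rw [inner_smul_left, this]
      simp
    exact eq_zero_of_mem_symmetric hsym (by simpa using hz) hmem
  obtain ⟨p, hp⟩ : x ∈ T.range := htop ▸ Submodule.mem_top
  refine ⟨p.1.1, ?_⟩
  have : x + z • p.1.1 = p.1.2 := by
    rw [← hp]
    exact sub_add_cancel _ _
  rw [this]
  exact p.2

/-- The resolvent `(A - z)⁻¹` of a selfadjoint relation. -/
theorem exists_resolvent {A : Submodule ℂ (E × E)} (hA : IsSelfAdjointRel A) {z : ℂ}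
    (hz : z.im ≠ 0) : ∃ R : E →L[ℂ] E, ∀ x u, (u, x + z • u) ∈ A ↔ u = R x := by
  have hsym : IsSymmetricRel A := hA.le
  have huniq : ∀ {x u v}, (u, x + z • u) ∈ A → (v, x + z • v) ∈ A → u = v := by
    intro x u v hu hv
    refine sub_eq_zero.1 (eq_zero_of_mem_symmetric hsym hz ?_)
    have := A.sub_mem hu hv
    rwa [Prod.mk_sub_mk, add_sub_add_left_eq_sub, ← smul_sub] at this
  choose r hr using exists_mem_selfAdjoint hA hz
  let R : E →ₗ[ℂ] E :=
    { toFun := r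
      map_add' := fun x y => huniq (hr _) <| by
        have := A.add_mem (hr x) (hr y)
        rwa [Prod.mk_add_mk, add_add_add_comm, ← smul_add] at this
      map_smul' := fun c x => huniq (hr _) <| by
        have := A.smul_mem c (hr x)
        rwa [Prod.smul_mk, smul_add, smul_comm] at this }
  have hR : ∀ x u, (u, x + z • u) ∈ A ↔ u = R x :=
    fun x u => ⟨fun h => huniq h (hr x), fun h => h ▸ hr x⟩
  have hgraph : IsClosed (R.graph : Set (E × E)) := by
    have : (R.graph : Set (E × E)) =
        (fun p : E × E => (p.2, p.1 + z • p.2)) ⁻¹' (A : Set (E × E)) := by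
      ext p
      exact (hR p.1 p.2).symm
    rw [this]
    exact (hA ▸ isClosed_adjoint A : IsClosed (A : Set (E × E))).preimage (by fun_prop)
  exact ⟨ContinuousLinearMap.ofIsClosedGraph hgraph, hR⟩

/-- The defect subspaces of a relation with a selfadjoint extension are linearly homeomorphic. -/
theorem nonempty_eigenspace_equiv {A T : Submodule ℂ (E × E)} (hA : IsSelfAdjointRel A)
    (hAT : A ≤ T) {z w : ℂ} (hz : z.im ≠ 0) (hw : w.im ≠ 0) :
    Nonempty (eigenspace T w ≃L[ℂ] eigenspace T z) := by
  obtain ⟨R, hR⟩ := exists_resolvent hA hz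
  obtain ⟨Q, hQ⟩ := exists_resolvent hA hw
  -- Put `u = R ((z - w) • f)`: adding `(u, (z - w) • f + z • u) ∈ A` to `(f, w • f)` gives `(f + u,
  -- z • (f + u))`.
  have key : ∀ {z w : ℂ} {R : E →L[ℂ] E}, (∀ x u, (u, x + z • u) ∈ A ↔ u = R x) →
      ∀ f ∈ eigenspace T w, f + R ((z - w) • f) ∈ eigenspace T z := by
    intro z w R hR f hf
    have := T.add_mem (mem_eigenspace.1 hf) (hAT ((hR ((z - w) • f) _).2 rfl))
    rw [mem_eigenspace]
    convert this using 1
    rw [Prod.mk_add_mk, Prod.mk.injEq]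
    exact ⟨rfl, by module⟩
  have inv : ∀ {z w : ℂ} {R Q : E →L[ℂ] E}, (∀ x u, (u, x + z • u) ∈ A ↔ u = R x) →
      (∀ x u, (u, x + w • u) ∈ A ↔ u = Q x) → ∀ f : E,
      f + R ((z - w) • f) + Q ((w - z) • (f + R ((z - w) • f))) = f := by
    intro z w R Q hR hQ f
    have h1 := A.neg_mem ((hR ((z - w) • f) _).2 rfl)
    -- The `w`-resolvent term equals `-R ((z - w) • f)`, since the negative of the pair in `A`
    -- defining `R ((z - w) • f)` solves its equation.
    rw [← (hQ ((w - z) • (f + R ((z - w) • f))) (-R ((z - w) • f))).1]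
    · abel
    · convert h1 using 1
      rw [Prod.neg_mk, Prod.mk.injEq]
      exact ⟨rfl, by module⟩
  let F : eigenspace T w →L[ℂ] eigenspace T z :=
    ((ContinuousLinearMap.id ℂ E + R ∘L ((z - w) • ContinuousLinearMap.id ℂ E)) ∘L
      (eigenspace T w).subtypeL).codRestrict _ fun f => key hR f f.2
  let G : eigenspace T z →L[ℂ] eigenspace T w :=
    ((ContinuousLinearMap.id ℂ E + Q ∘L ((w - z) • ContinuousLinearMap.id ℂ E)) ∘L
      (eigenspace T z).subtypeL).codRestrict _ fun f => key hQ f f.2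
  exact ⟨ContinuousLinearEquiv.equivOfInverse F G (fun f => Subtype.ext (inv hR hQ f))
    fun f => Subtype.ext (inv hQ hR f)⟩

/-- A relation with a selfadjoint extension has equal defect numbers. -/
theorem hasEqualDefectNumbers_of_le {A S : Submodule ℂ (E × E)} (hA : IsSelfAdjointRel A)
    (hAS : A ≤ S.adjoint) : HasEqualDefectNumbers S := by
  intro z w hz hw
  have hcl : ∀ z, CompleteSpace (eigenspace S.adjoint z) := fun z =>
    ((isClosed_adjoint S).preimage (f := fun f : E => (f, z • f)) (by fun_prop)).completeSpace_coe
  have := hcl z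
  have := hcl w
  obtain ⟨e⟩ := nonempty_eigenspace_equiv hA hAS hw.ne hz.ne'
  obtain ⟨e'⟩ := nonempty_linearIsometryEquiv e
  exact hilbertDim_congr e'

end Resolvent

/-! ### The `γ`-field and the Weyl function -/

section WeylFunction

variable {E K : Type*} [NormedAddCommGroup E] [InnerProductSpace ℂ E]
  [NormedAddCommGroup K] [InnerProductSpace ℂ K]

theorem mem_weylFamily {Γ : Submodule ℂ ((E × E) × (K × K))} {z : ℂ} {h : K × K} :
    h ∈ weylFamily Γ z ↔ ∃ f, ((f, z • f), h) ∈ Γ := by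
  simp [weylFamily, mem_ran, eigenEmbedding]

theorem mem_gammaField {Γ : Submodule ℂ ((E × E) × (K × K))} {z : ℂ} {h : K} {f : E} :
    (h, f) ∈ gammaField Γ z ↔ ∃ h', ((f, z • f), (h, h')) ∈ Γ := by
  simp [gammaField, eigenEmbedding]

/-- Under (B1)-(B3), the restriction of `Γ` to the eigenspace at a nonreal point is
parametrized by two bounded operators, the values of the `γ`-field and of the Weyl function. -/
theorem SatisfiesB.exists_gamma_weyl [CompleteSpace E] [CompleteSpace K]
    {Γ : Submodule ℂ ((E × E) × (K × K))} (hB : SatisfiesB Γ) {z : ℂ} (hz : z.im ≠ 0) :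
    ∃ (γ : K →L[ℂ] E) (M : K →L[ℂ] K), ∀ f h h',
      ((f, z • f), (h, h')) ∈ Γ ↔ f = γ h ∧ h' = M h := by
  have hex : ∀ h : K, ∃ p : E × K, ((p.1, z • p.1), (h, p.2)) ∈ Γ := by
    intro h
    obtain ⟨f, h', hf⟩ := hB.exists_mem h
    -- Subtracting this element of `ker Γ₀` turns `f` into an eigen-element at `z` without changing
    -- `h`.
    obtain ⟨u, hu⟩ := exists_mem_selfAdjoint hB.b3 hz (f.2 - z • f.1)
    obtain ⟨k, hk⟩ := mem_ker_Gamma0.1 hu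
    refine ⟨(f.1 - u, h' - k), ?_⟩
    convert Γ.sub_mem hf hk using 1
    ext
    · rfl
    · simp only [Prod.fst_sub, Prod.snd_sub]
      module
    · simp
    · rfl
  have hzero : ∀ {f h'}, ((f, z • f), ((0 : K), h')) ∈ Γ → f = 0 ∧ h' = 0 := by
    intro f h' hf
    have h0 : f = 0 := eq_zero_of_mem_symmetric hB.b3.le hz (mem_ker_Gamma0.2 ⟨h', hf⟩)
    subst h0
    refine ⟨rfl, hB.eq_zero_of_green fun p hp => hB.b1 p hp _ ?_⟩
    rwa [smul_zero] at hf
  have huniq : ∀ {h : K} {p q : E × K}, ((p.1, z • p.1), (h, p.2)) ∈ Γ →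
      ((q.1, z • q.1), (h, q.2)) ∈ Γ → p = q := by
    intro h p q hp hq
    have h1 := Γ.sub_mem hp hq
    simp only [Prod.mk_sub_mk, ← smul_sub, sub_self] at h1
    obtain ⟨h2, h3⟩ := hzero h1
    exact Prod.ext (sub_eq_zero.1 h2) (sub_eq_zero.1 h3)
  choose l hl using hex
  let L : K →ₗ[ℂ] E × K :=
    { toFun := l
      map_add' := fun x y => huniq (hl _) <| by
        simpa using Γ.add_mem (hl x) (hl y)
      map_smul' := fun c x => huniq (hl _) <| by
        simpa [smul_comm c z] using Γ.smul_mem c (hl x) }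
  have hL : ∀ h p, ((p.1, z • p.1), (h, p.2)) ∈ Γ ↔ p = L h :=
    fun h p => ⟨fun hp => huniq hp (hl h), fun hp => hp ▸ hl h⟩
  -- The graph is a continuous preimage of the closed relation `Γ`, so both operators are bounded at
  -- once.
  have hgraph : IsClosed (L.graph : Set (K × (E × K))) := by
    have : (L.graph : Set (K × (E × K))) =
        (fun p : K × (E × K) => ((p.2.1, z • p.2.1), (p.1, p.2.2))) ⁻¹'
          (Γ : Set ((E × E) × (K × K))) := by
      ext p
      exact (hL p.1 p.2).symm
    rw [this]
    exact hB.isClosed.preimage (by fun_prop)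
  let L' : K →L[ℂ] E × K := ContinuousLinearMap.ofIsClosedGraph hgraph
  refine ⟨ContinuousLinearMap.fst ℂ E K ∘L L', ContinuousLinearMap.snd ℂ E K ∘L L',
    fun f h h' => ?_⟩
  exact (hL h (f, h')).trans Prod.ext_iff

end WeylFunction

end BoundaryRel

open BoundaryRel in
theorem proposition5p1
    {E K : Type*} [NormedAddCommGroup E] [InnerProductSpace ℂ E] [CompleteSpace E]
    [NormedAddCommGroup K] [InnerProductSpace ℂ K] [CompleteSpace K]
    (S : Submodule ℂ (E × E)) (Γ : Submodule ℂ ((E × E) × (K × K)))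
    (hΓ : BoundaryRel.IsBoundaryRelation S Γ) (hB : BoundaryRel.SatisfiesB Γ)
    (K₁ K₂ : Submodule ℂ K) [CompleteSpace K₁] [CompleteSpace K₂] (hK : K₂ = K₁ᗮ) :
    -- (i)
    (IsClosed (BoundaryRel.interExt S Γ K₂ : Set (E × E)) ∧
      BoundaryRel.IsSymmetricRel (BoundaryRel.interExt S Γ K₂) ∧
      BoundaryRel.HasEqualDefectNumbers (BoundaryRel.interExt S Γ K₂)) ∧
    -- (ii)
    ((BoundaryRel.compressed Γ K₁ : Set ((E × E) × (K₁ × K₁))) =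
        {p | ∃ (f : E × E) (h : K₁) (h' : K), (f, ((h : K), h')) ∈ Γ ∧
          p = (f, (h, K₁.orthogonalProjectionOnto h'))} ∧
      BoundaryRel.IsBoundaryRelation (BoundaryRel.interExt S Γ K₂)
        (BoundaryRel.compressed Γ K₁) ∧
      BoundaryRel.SatisfiesB (BoundaryRel.compressed Γ K₁)) ∧
    -- (iii)
    ((BoundaryRel.dom (BoundaryRel.compressed Γ K₁)).topologicalClosure =
        (BoundaryRel.interExt S Γ K₂).adjoint ∧
      (BoundaryRel.dom (BoundaryRel.compressed Γ K₁) : Set (E × E)) =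
        {f | f ∈ S.adjoint ∧ ∃ h h' : K, (f, (h, h')) ∈ Γ ∧
          K₂.orthogonalProjectionOnto h = 0}) ∧
    -- (iv)
    (∀ z : ℂ, z.im ≠ 0 →
      ∃ (M : K →L[ℂ] K) (γ : K →L[ℂ] E),
        BoundaryRel.weylFamily Γ z = (M : K →ₗ[ℂ] K).graph ∧
        BoundaryRel.gammaField Γ z = (γ : K →ₗ[ℂ] E).graph ∧
        BoundaryRel.gammaField (BoundaryRel.compressed Γ K₁) z =
          ((γ ∘L K₁.subtypeL : K₁ →L[ℂ] E) : K₁ →ₗ[ℂ] E).graph ∧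
        BoundaryRel.weylFamily (BoundaryRel.compressed Γ K₁) z =
          ((K₁.orthogonalProjectionOnto ∘L M ∘L K₁.subtypeL : K₁ →L[ℂ] K₁) :
            K₁ →ₗ[ℂ] K₁).graph) := by

  subst hK
  have hB₁ : SatisfiesB (compressed Γ K₁) := hB.compressed
  have hH := interExt_eq_adjoint_dom (K₁ := K₁) hΓ.dom_le hB
  have hb : IsBoundaryRelation (interExt S Γ K₁ᗮ) (compressed Γ K₁) := hH ▸ hB₁.isBoundaryRelation
  have hcl : (dom (compressed Γ K₁)).topologicalClosure = (interExt S Γ K₁ᗮ).adjoint :=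
    hH ▸ (adjoint_adjoint _).symm
  refine ⟨⟨hb.isClosed, hb.isSymmetric, hasEqualDefectNumbers_of_le hB₁.b3 ?_⟩,
    ⟨?_, hb, hB₁⟩, ⟨hcl, ?_⟩, ?_⟩
  -- The selfadjoint extension used here is `ker Γ₀` of the compressed relation.
  · intro f hf
    obtain ⟨h', hf⟩ := mem_ker_Gamma0.1 hf
    exact hb.dom_le (mem_dom.2 ⟨_, hf⟩)
  · ext ⟨f, h, k⟩
    constructor
    · intro hp
      obtain ⟨h', hp', rfl⟩ := mem_compressed.1 hp
      exact ⟨f, h, h', hp', rfl⟩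
    · rintro ⟨f, h, h', hp, heq⟩
      rw [heq]
      exact mem_compressed.2 ⟨h', hp, rfl⟩
  · ext f
    refine mem_dom_compressed.trans ?_
    have hmem : ∀ h : K, K₁ᗮ.orthogonalProjectionOnto h = 0 ↔ h ∈ K₁ := fun h => by
      rw [Submodule.orthogonalProjectionOnto_eq_zero_iff, Submodule.orthogonal_orthogonal]
    constructor
    · rintro ⟨h, hh, h', hp⟩
      exact ⟨hΓ.dom_le (mem_dom.2 ⟨_, hp⟩), h, h', hp, (hmem h).2 hh⟩
    · rintro ⟨_, h, h', hp, hh⟩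
      exact ⟨h, (hmem h).1 hh, h', hp⟩
  · intro z hz
    obtain ⟨γ, M, hγM⟩ := hB.exists_gamma_weyl hz
    refine ⟨M, γ, ?_, ?_, ?_, ?_⟩
    · ext ⟨h, h'⟩
      simp [mem_weylFamily, hγM, LinearMap.mem_graph_iff]
    · ext ⟨h, f⟩
      simp [mem_gammaField, hγM, LinearMap.mem_graph_iff]
    · ext ⟨h, f⟩
      simp [mem_gammaField, mem_compressed, hγM, LinearMap.mem_graph_iff]
    · ext ⟨h, h'⟩
      simp [mem_weylFamily, mem_compressed, hγM, LinearMap.mem_graph_iff]
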